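/- Let $\mathcal{C}$ be a small additive category. An exact structure $\mathcal{E}$ on an additive category is an isomorphism-closed class of kernel–cokernel pairs ($\mathcal{E}$-short exact sequences) satisfying Quillen's axioms; exact structures are ordered by inclusion of the classes of short exact sequences, and $\mathcal{E}\wedge\mathcal{F}$ denotes the meet (greatest lower bound) of $\mathcal{E}$ and $\mathcal{F}$ in this order; its short exact sequences are those that are both $\mathcal{E}$- and $\mathcal{F}$-short exact. Let $\overrightarrow{\mathcal{C}}$ be the ind-completion of $\mathcal{C}$, that is, the full subcategory of the category of additive functors $\mathcal{C}^{op}\to \mathrm{Ab}$ consisting of the small filtered colimits of representable functors $\mathrm{Hom}_{\mathcal{C}}(-,X)$. For an exact structure $\mathcal{E}$ on $\mathcal{C}$ let $\mathrm{Lex}(\mathcal{E}^{op},\mathrm{Ab})$ be the abelian category of additive functors $F\colon\mathcal{C}^{op}\to\mathrm{Ab}$ such that $0\to F(Z)\to F(Y)\to F(X)$ is exact for every $\mathcal{E}$-short exact sequence $X\to Y\to Z$. Then $\overrightarrow{\mathcal{C}}$ is an extension-closed full subcategory of $\mathrm{Lex}(\mathcal{E}^{op},\mathrm{Ab})$, and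 the ind-completion $\overrightarrow{\mathcal{E}}$ of $\mathcal{E}$ is the induced exact structure on $\overrightarrow{\mathcal{C}}$: its short exact sequences are the sequences in $\overrightarrow{\mathcal{C}}$ which are short exact in the abelian category $\mathrm{Lex}(\mathcal{E}^{op},\mathrm{Ab})$. Then, for any two exact structures $\mathcal{E}$ and $\mathcal{F}$ on $\mathcal{C}$, \[ \overrightarrow{\mathcal{E}}\wedge\overrightarrow{\mathcal{F}}=\overrightarrow{\mathcal{E}\wedge\mathcal{F}} \] as exact structures on $\overrightarrow{\mathcal{C}}$. -/

import Mathlib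

universe u v w

open CategoryTheory Limits Opposite

set_option linter.unusedSectionVars false

namespace ExactCat

section Basic

variable {A : Type u} [Category.{v} A] [Preadditive A]

/-- A pair of composable morphisms `X ⟶ Y ⟶ Z` is a kernel-cokernel pair if the first morphism is
a kernel of the second one and the second one is a cokernel of the first one. -/
def IsKernelCokernelPair (S : ShortComplex A) : Prop :=
  Nonempty (IsLimit (KernelFork.ofι S.f S.zero)) ∧
    Nonempty (IsColimit (CokernelCofork.ofπ S.g S.zero))

/-- A morphism is an inflation (admissible monic) for a class `W` of short complexes
if it is the first morphism of a member of `W`. -/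
def IsInflation (W : ObjectProperty (ShortComplex A)) {X Y : A} (i : X ⟶ Y) : Prop :=
  ∃ (Z : A) (p : Y ⟶ Z) (w : i ≫ p = 0), W (ShortComplex.mk i p w)

/-- A morphism is a deflation (admissible epic) for a class `W` of short complexes
if it is the second morphism of a member of `W`. -/
def IsDeflation (W : ObjectProperty (ShortComplex A)) {Y Z : A} (p : Y ⟶ Z) : Prop :=
  ∃ (X : A) (i : X ⟶ Y) (w : i ≫ p = 0), W (ShortComplex.mk i p w)

/-- An exact structure (in the sense of Quillen, axioms as in Bühler's survey) on an additive
category: a class of kernel-cokernel pairs, called conflations or short exact sequences, closed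
under isomorphisms and satisfying the axioms E0, E0ᵒᵖ, E1, E1ᵒᵖ, E2, E2ᵒᵖ. -/
@[ext]
structure ExactStructure (A : Type u) [Category.{v} A] [Preadditive A] where
  conflation : ObjectProperty (ShortComplex A)
  isKernelCokernelPair : ∀ S, conflation S → IsKernelCokernelPair S
  of_iso : ∀ {S T : ShortComplex A}, (S ≅ T) → conflation S → conflation T
  inflation_id : ∀ X : A, IsInflation conflation (𝟙 X)
  deflation_id : ∀ X : A, IsDeflation conflation (𝟙 X)
  inflation_comp : ∀ {X Y Z : A} (i : X ⟶ Y) (j : Y ⟶ Z),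
    IsInflation conflation i → IsInflation conflation j → IsInflation conflation (i ≫ j)
  deflation_comp : ∀ {X Y Z : A} (p : X ⟶ Y) (q : Y ⟶ Z),
    IsDeflation conflation p → IsDeflation conflation q → IsDeflation conflation (p ≫ q)
  inflation_pushout : ∀ {X Y X' : A} (i : X ⟶ Y) (f : X ⟶ X'), IsInflation conflation i →
    ∃ (Y' : A) (f' : Y ⟶ Y') (i' : X' ⟶ Y'), IsPushout i f f' i' ∧ IsInflation conflation i'
  deflation_pullback : ∀ {Y Z Z' : A} (p : Y ⟶ Z) (f : Z' ⟶ Z), IsDeflation conflation p →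
    ∃ (Y' : A) (f' : Y' ⟶ Y) (p' : Y' ⟶ Z'), IsPullback f' p' p f ∧ IsDeflation conflation p'

namespace ExactStructure

/-- Copy of an exact structure with a new but equal class of conflations. -/
def copy (E : ExactStructure A) (W : ObjectProperty (ShortComplex A)) (h : W = E.conflation) :
    ExactStructure A where
  conflation := W
  isKernelCokernelPair := by subst h; exact E.isKernelCokernelPair
  of_iso := by subst h; exact E.of_iso
  inflation_id := by subst h; exact E.inflation_id
  deflation_id := by subst h; exact E.deflation_id
  inflation_comp := by subst h; exact E.inflation_comp
  deflation_comp := by subst h; exact E.deflation_comp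
  inflation_pushout := by subst h; exact E.inflation_pushout
  deflation_pullback := by subst h; exact E.deflation_pullback

/-- Exact structures are ordered by inclusion of their classes of conflations. -/
instance : PartialOrder (ExactStructure A) where
  le E F := E.conflation ≤ F.conflation
  le_refl E := le_refl E.conflation
  le_trans E F G h h' := le_trans (a := E.conflation) h h'
  le_antisymm E F h h' := ExactStructure.ext (le_antisymm h h')

variable (E F : ExactStructure A)

lemma conflation_of_inflation {X Y Z : A} (i : X ⟶ Y) (p : Y ⟶ Z) (w : i ≫ p = 0)
    (hi : IsInflation E.conflation i) (h : Nonempty (IsColimit (CokernelCofork.ofπ p w))) :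
    E.conflation (ShortComplex.mk i p w) := by
  obtain ⟨Z', p', w', h'⟩ := hi
  obtain ⟨-, ⟨hc'⟩⟩ := E.isKernelCokernelPair _ h'
  obtain ⟨hc⟩ := h
  let e : Z' ≅ Z := hc'.coconePointUniqueUpToIso hc
  have he : p' ≫ e.hom = p :=
    hc'.comp_coconePointUniqueUpToIso_hom hc WalkingParallelPair.one
  let φ : ShortComplex.mk i p' w' ≅ ShortComplex.mk i p w :=
    ShortComplex.isoMk (Iso.refl _) (Iso.refl _) e (by simp) (by simp [he])
  exact E.of_iso φ h'

lemma conflation_of_deflation {X Y Z : A} (i : X ⟶ Y) (p : Y ⟶ Z) (w : i ≫ p = 0)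
    (hp : IsDeflation E.conflation p) (h : Nonempty (IsLimit (KernelFork.ofι i w))) :
    E.conflation (ShortComplex.mk i p w) := by
  obtain ⟨X', i', w', h'⟩ := hp
  obtain ⟨⟨hc'⟩, -⟩ := E.isKernelCokernelPair _ h'
  obtain ⟨hc⟩ := h
  let e : X' ≅ X := hc'.conePointUniqueUpToIso hc
  have he : e.hom ≫ i = i' :=
    hc'.conePointUniqueUpToIso_hom_comp hc WalkingParallelPair.zero
  let φ : ShortComplex.mk i' p w' ≅ ShortComplex.mk i p w :=
    ShortComplex.isoMk e (Iso.refl _) (Iso.refl _) (by simp [he]) (by simp)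
  exact E.of_iso φ h'

lemma inflation_inf {X Y : A} {i : X ⟶ Y} (hE : IsInflation E.conflation i)
    (hF : IsInflation F.conflation i) : IsInflation (E.conflation ⊓ F.conflation) i := by
  obtain ⟨Z, p, w, h⟩ := hE
  exact ⟨Z, p, w, h, F.conflation_of_inflation i p w hF (E.isKernelCokernelPair _ h).2⟩

lemma deflation_inf {Y Z : A} {p : Y ⟶ Z} (hE : IsDeflation E.conflation p)
    (hF : IsDeflation F.conflation p) : IsDeflation (E.conflation ⊓ F.conflation) p := by
  obtain ⟨X, i, w, h⟩ := hE
  exact ⟨X, i, w, h, F.conflation_of_deflation i p w hF (E.isKernelCokernelPair _ h).1⟩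

lemma inflation_of_iso {X Y Y' : A} {i : X ⟶ Y} (hi : IsInflation E.conflation i) (e : Y ≅ Y')
    (i' : X ⟶ Y') (h : i ≫ e.hom = i') : IsInflation E.conflation i' := by
  obtain ⟨Z, p, w, hp⟩ := hi
  subst h
  let φ : ShortComplex.mk i p w ≅ ShortComplex.mk (i ≫ e.hom) (e.inv ≫ p) (by simp [w]) :=
    ShortComplex.isoMk (Iso.refl _) e (Iso.refl _) (by simp) (by simp)
  exact ⟨Z, e.inv ≫ p, by simp [w], E.of_iso φ hp⟩

lemma deflation_of_iso {X X' Y : A} {p : X ⟶ Y} (hp : IsDeflation E.conflation p) (e : X ≅ X')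
    (p' : X' ⟶ Y) (h : e.hom ≫ p' = p) : IsDeflation E.conflation p' := by
  obtain ⟨Z, i, w, hi⟩ := hp
  subst h
  let φ : ShortComplex.mk i (e.hom ≫ p') w ≅ ShortComplex.mk (i ≫ e.hom) p' (by simpa using w) :=
    ShortComplex.isoMk (Iso.refl _) e (Iso.refl _) (by simp) (by simp)
  exact ⟨Z, i ≫ e.hom, by simpa using w, E.of_iso φ hi⟩

/-- The meet of two exact structures: its conflations are the common conflations. By the
`SemilatticeInf` axioms, it is the greatest lower bound in the poset of exact structures. -/
instance : SemilatticeInf (ExactStructure A) where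
  inf E F :=
    { conflation := E.conflation ⊓ F.conflation
      isKernelCokernelPair := fun S hS => E.isKernelCokernelPair S hS.1
      of_iso := fun e h => ⟨E.of_iso e h.1, F.of_iso e h.2⟩
      inflation_id := fun X => inflation_inf E F (E.inflation_id X) (F.inflation_id X)
      deflation_id := fun X => deflation_inf E F (E.deflation_id X) (F.deflation_id X)
      inflation_comp := fun i j ⟨Z, p, w, h⟩ ⟨Z', p', w', h'⟩ => inflation_inf E F
        (E.inflation_comp i j ⟨Z, p, w, h.1⟩ ⟨Z', p', w', h'.1⟩)
        (F.inflation_comp i j ⟨Z, p, w, h.2⟩ ⟨Z', p', w', h'.2⟩)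
      deflation_comp := fun i j ⟨Z, p, w, h⟩ ⟨Z', p', w', h'⟩ => deflation_inf E F
        (E.deflation_comp i j ⟨Z, p, w, h.1⟩ ⟨Z', p', w', h'.1⟩)
        (F.deflation_comp i j ⟨Z, p, w, h.2⟩ ⟨Z', p', w', h'.2⟩)
      inflation_pushout := fun i f ⟨Z, p, w, h⟩ => by
        obtain ⟨Y, f₁, i₁, sq, h₁⟩ := E.inflation_pushout i f ⟨Z, p, w, h.1⟩
        obtain ⟨Y', f₂, i₂, sq', h₂⟩ := F.inflation_pushout i f ⟨Z, p, w, h.2⟩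
        exact ⟨Y, f₁, i₁, sq, inflation_inf E F h₁ (F.inflation_of_iso h₂
          (sq'.isoIsPushout _ _ sq) i₁ (by simp))⟩
      deflation_pullback := fun p f ⟨X, i, w, h⟩ => by
        obtain ⟨Y, f₁, p₁, sq, h₁⟩ := E.deflation_pullback p f ⟨X, i, w, h.1⟩
        obtain ⟨Y', f₂, p₂, sq', h₂⟩ := F.deflation_pullback p f ⟨X, i, w, h.2⟩
        exact ⟨Y, f₁, p₁, sq, deflation_inf E F h₁ (F.deflation_of_iso h₂
          (sq'.isoIsPullback _ _ sq) p₁ (by simp))⟩ }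
  inf_le_left E F := inf_le_left (a := E.conflation)
  inf_le_right E F := inf_le_right (a := E.conflation)
  le_inf E F G h h' := fun S hS => ⟨h S hS, h' S hS⟩

end ExactStructure

end Basic

section FullyExact

variable {B : Type u} [Category.{v} B] [Preadditive B] {D : Type w} [Category.{v} D] [Abelian D]
  (Φ : B ⥤ D) [Φ.Additive] [Φ.Full] [Φ.Faithful]

lemma isKernelCokernelPair_of_map_shortExact (S : ShortComplex B) (h : (S.map Φ).ShortExact) :
    IsKernelCokernelPair S := by
  have := h.mono_f
  have := h.epi_g
  refine ⟨⟨?_⟩, ⟨?_⟩⟩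
  · have : Mono S.f := Φ.mono_of_mono_map h.mono_f
    refine KernelFork.IsLimit.ofι' _ _ fun {W} k hk => ?_
    have hk' : Φ.map k ≫ (S.map Φ).g = 0 := by
      change Φ.map k ≫ Φ.map S.g = 0
      rw [← Φ.map_comp, hk, Φ.map_zero]
    refine ⟨Φ.preimage (h.exact.lift (Φ.map k) hk'), Φ.map_injective ?_⟩
    exact (Φ.map_comp _ _).trans
      ((congrArg (· ≫ Φ.map S.f) (Φ.map_preimage _)).trans (h.exact.lift_f _ hk'))
  · have : Epi S.g := Φ.epi_of_epi_map h.epi_g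
    refine CokernelCofork.IsColimit.ofπ' _ _ fun {W} k hk => ?_
    have hk' : (S.map Φ).f ≫ Φ.map k = 0 := by
      change Φ.map S.f ≫ Φ.map k = 0
      rw [← Φ.map_comp, hk, Φ.map_zero]
    refine ⟨Φ.preimage (h.exact.desc (Φ.map k) hk'), Φ.map_injective ?_⟩
    exact (Φ.map_comp _ _).trans
      ((congrArg (Φ.map S.g ≫ ·) (Φ.map_preimage _)).trans (h.exact.g_desc _ hk'))

lemma isInflation_iff {X Y : B} (i : X ⟶ Y) :
    IsInflation (fun S : ShortComplex B => (S.map Φ).ShortExact) i ↔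
      Mono (Φ.map i) ∧ Φ.essImage (cokernel (Φ.map i)) := by
  constructor
  · rintro ⟨Z, p, w, h⟩
    exact ⟨h.mono_f, Z, ⟨h.gIsCokernel.coconePointUniqueUpToIso (colimit.isColimit _)⟩⟩
  · rintro ⟨_, Z, ⟨e⟩⟩
    have w : i ≫ Φ.preimage (cokernel.π (Φ.map i) ≫ e.inv) = 0 := Φ.map_injective (by simp)
    refine ⟨Z, Φ.preimage (cokernel.π (Φ.map i) ≫ e.inv), w, ?_⟩
    have h : (ShortComplex.mk (Φ.map i) (cokernel.π (Φ.map i)) (by simp)).ShortExact :=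
      { exact := ShortComplex.exact_cokernel _
        mono_f := by dsimp; infer_instance
        epi_g := by dsimp; infer_instance }
    let φ : ShortComplex.mk (Φ.map i) (cokernel.π (Φ.map i)) (by simp) ≅
        (ShortComplex.mk i (Φ.preimage (cokernel.π (Φ.map i) ≫ e.inv)) w).map Φ :=
      ShortComplex.isoMk (Iso.refl _) (Iso.refl _) e.symm
        ((Category.id_comp _).trans (Category.comp_id _).symm)
        ((Category.id_comp _).trans (Φ.map_preimage _))
    exact ShortComplex.shortExact_of_iso φ h

lemma isDeflation_iff {X Y : B} (p : X ⟶ Y) :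
    IsDeflation (fun S : ShortComplex B => (S.map Φ).ShortExact) p ↔
      Epi (Φ.map p) ∧ Φ.essImage (kernel (Φ.map p)) := by
  constructor
  · rintro ⟨Z, i, w, h⟩
    exact ⟨h.epi_g, Z, ⟨h.fIsKernel.conePointUniqueUpToIso (limit.isLimit _)⟩⟩
  · rintro ⟨_, Z, ⟨e⟩⟩
    have w : Φ.preimage (e.hom ≫ kernel.ι (Φ.map p)) ≫ p = 0 := Φ.map_injective (by simp)
    refine ⟨Z, Φ.preimage (e.hom ≫ kernel.ι (Φ.map p)), w, ?_⟩
    have h : (ShortComplex.mk (kernel.ι (Φ.map p)) (Φ.map p) (by simp)).ShortExact :=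
      { exact := ShortComplex.exact_kernel _
        mono_f := by dsimp; infer_instance
        epi_g := by dsimp; infer_instance }
    let φ : ShortComplex.mk (kernel.ι (Φ.map p)) (Φ.map p) (by simp) ≅
        (ShortComplex.mk (Φ.preimage (e.hom ≫ kernel.ι (Φ.map p))) p w).map Φ :=
      ShortComplex.isoMk e.symm (Iso.refl _) (Iso.refl _)
        ((congrArg (e.inv ≫ ·) (Φ.map_preimage _)).trans
          ((e.inv_hom_id_assoc _).trans (Category.comp_id _).symm))
        ((Category.id_comp _).trans (Category.comp_id _).symm)
    exact ShortComplex.shortExact_of_iso φ h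

/-- The fully exact structure on a full additive subcategory `Φ : B ⥤ D` of an abelian category
which is closed under extensions. -/
def fullyExact (h0 : ∃ Z : B, IsZero (Φ.obj Z)) (hext : Φ.essImage.IsClosedUnderExtensions) :
    ExactStructure B where
  conflation := fun S => (S.map Φ).ShortExact
  isKernelCokernelPair := isKernelCokernelPair_of_map_shortExact Φ
  of_iso e h := ShortComplex.shortExact_of_iso (Φ.mapShortComplex.mapIso e) h
  inflation_id X := by
    obtain ⟨Z, hZ⟩ := h0
    rw [isInflation_iff]
    refine ⟨inferInstance, Z, ⟨hZ.iso ?_⟩⟩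
    exact IsZero.of_epi_eq_zero (cokernel.π (Φ.map (𝟙 X))) (by
      simpa using cokernel.condition (Φ.map (𝟙 X)))
  deflation_id X := by
    obtain ⟨Z, hZ⟩ := h0
    rw [isDeflation_iff]
    refine ⟨inferInstance, Z, ⟨hZ.iso ?_⟩⟩
    exact IsZero.of_mono_eq_zero (kernel.ι (Φ.map (𝟙 X))) (by
      simpa using kernel.condition (Φ.map (𝟙 X)))
  inflation_comp {X Y Z} i j hi hj := by
    rw [isInflation_iff] at hi hj ⊢
    obtain ⟨_, hi⟩ := hi
    obtain ⟨_, hj⟩ := hj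
    rw [Φ.map_comp]
    refine ⟨mono_comp _ _, ?_⟩
    have sq : IsPullback (Φ.map i) (𝟙 _) (Φ.map j) (Φ.map i ≫ Φ.map j) :=
      ⟨⟨by simp⟩, ⟨PullbackCone.IsLimit.mk _ (fun s => s.snd)
        (fun s => by rw [← cancel_mono (Φ.map j)]; simp [s.condition]) (fun s => by simp)
        (fun s m _ h => by simpa using h)⟩⟩
    have hm := Abelian.mono_cokernel_map_of_isPullback sq
    have hex := (kernelCokernelCompSequence_exact (Φ.map i) (Φ.map j)).exact 3
    refine hext.prop_X₂_of_shortExact (S := ShortComplex.mk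
      (cokernel.map (Φ.map i) (Φ.map i ≫ Φ.map j) (𝟙 _) (Φ.map j) (by simp))
      (cokernel.map (Φ.map i ≫ Φ.map j) (Φ.map j) (Φ.map i) (𝟙 _) (by simp)) (by
        ext; simp)) ?_ hi hj
    exact
      { exact := hex
        mono_f := hm
        epi_g := by
          dsimp
          exact epi_of_epi_fac (f := cokernel.π (Φ.map i ≫ Φ.map j))
            (h := cokernel.π (Φ.map j)) (by simp) }
  deflation_comp {X Y Z} i j hi hj := by
    rw [isDeflation_iff] at hi hj ⊢
    obtain ⟨_, hi⟩ := hi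
    obtain ⟨_, hj⟩ := hj
    rw [Φ.map_comp]
    refine ⟨epi_comp _ _, ?_⟩
    have sq : IsPushout (Φ.map i ≫ Φ.map j) (Φ.map i) (𝟙 _) (Φ.map j) :=
      ⟨⟨by simp⟩, ⟨PushoutCocone.IsColimit.mk _ (fun s => s.inl)
        (fun s => by simp)
        (fun s => by rw [← cancel_epi (Φ.map i)]; simpa using s.condition)
        (fun s m h _ => by simpa using h)⟩⟩
    have hm := Abelian.epi_kernel_map_of_isPushout sq
    have hex := (kernelCokernelCompSequence_exact (Φ.map i) (Φ.map j)).exact 0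
    refine hext.prop_X₂_of_shortExact (S := ShortComplex.mk
      (kernel.map (Φ.map i) (Φ.map i ≫ Φ.map j) (𝟙 _) (Φ.map j) (by simp))
      (kernel.map (Φ.map i ≫ Φ.map j) (Φ.map j) (Φ.map i) (𝟙 _) (by simp)) (by
        ext; simp)) ?_ hi hj
    exact
      { exact := hex
        mono_f := by
          dsimp
          have : kernel.map (Φ.map i) (Φ.map i ≫ Φ.map j) (𝟙 _) (Φ.map j) (by simp) ≫
            kernel.ι (Φ.map i ≫ Φ.map j) = kernel.ι (Φ.map i) := by simp
          exact mono_of_mono_fac this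
        epi_g := hm }
  inflation_pushout {X Y X'} i f hi := by
    rw [isInflation_iff] at hi
    obtain ⟨_, hi⟩ := hi
    have sq := IsPushout.of_hasPushout (Φ.map i) (Φ.map f)
    have hiso := isIso_cokernel_map_of_isPushout sq
    have hm : Mono (pushout.inr (Φ.map i) (Φ.map f)) := inferInstance
    have hc : Φ.essImage (cokernel (pushout.inr (Φ.map i) (Φ.map f))) :=
      Functor.essImage.ofIso (asIso (cokernel.map _ _ _ _ sq.w)) hi
    obtain ⟨Y', ⟨e⟩⟩ : Φ.essImage (pushout (Φ.map i) (Φ.map f)) :=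
      hext.prop_X₂_of_shortExact (S := ShortComplex.mk (pushout.inr (Φ.map i) (Φ.map f))
        (cokernel.π _) (by simp))
        { exact := ShortComplex.exact_cokernel _
          mono_f := by dsimp; infer_instance
          epi_g := by dsimp; infer_instance } ⟨X', ⟨Iso.refl _⟩⟩ hc
    refine ⟨Y', Φ.preimage (pushout.inl _ _ ≫ e.inv), Φ.preimage (pushout.inr _ _ ≫ e.inv), ?_, ?_⟩
    · refine IsPushout.of_map Φ (Φ.map_injective ?_) ?_
      · simp [reassoc_of% sq.w]
      · simpa using sq.of_iso (Iso.refl _) (Iso.refl _) (Iso.refl _) e.symm (by simp) (by simp)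
          (by simp) (by simp)
    · rw [isInflation_iff, Φ.map_preimage]
      exact ⟨inferInstance, Functor.essImage.ofIso (cokernelCompIsIso _ _).symm hc⟩
  deflation_pullback {Y Z Z'} p f hp := by
    rw [isDeflation_iff] at hp
    obtain ⟨_, hp⟩ := hp
    have sq := IsPullback.of_hasPullback (Φ.map p) (Φ.map f)
    have hiso := isIso_kernel_map_of_isPullback sq.flip
    have hm : Epi (pullback.snd (Φ.map p) (Φ.map f)) := inferInstance
    have hc : Φ.essImage (kernel (pullback.snd (Φ.map p) (Φ.map f))) :=
      Functor.essImage.ofIso (asIso (kernel.map _ _ _ _ sq.flip.w)).symm hp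
    obtain ⟨Y', ⟨e⟩⟩ : Φ.essImage (pullback (Φ.map p) (Φ.map f)) :=
      hext.prop_X₂_of_shortExact (S := ShortComplex.mk (kernel.ι _)
        (pullback.snd (Φ.map p) (Φ.map f)) (by simp))
        { exact := ShortComplex.exact_kernel _
          mono_f := by dsimp; infer_instance
          epi_g := by dsimp; infer_instance } hc ⟨Z', ⟨Iso.refl _⟩⟩
    refine ⟨Y', Φ.preimage (e.hom ≫ pullback.fst _ _), Φ.preimage (e.hom ≫ pullback.snd _ _), ?_, ?_⟩
    · refine IsPullback.of_map Φ (Φ.map_injective ?_) ?_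
      · simp [sq.w]
      · simpa using sq.of_iso e.symm (Iso.refl _) (Iso.refl _) (Iso.refl _) (by simp) (by simp)
          (by simp) (by simp)
    · rw [isDeflation_iff, Φ.map_preimage]
      exact ⟨inferInstance, Functor.essImage.ofIso (kernelIsIsoComp _ _).symm hc⟩

end FullyExact


section Ind

variable {C : Type u} [SmallCategory C] [Preadditive C]

/-- The ind-completion of `C`, as a class of presheaves of abelian groups: the filtered colimits
`colim (-, Xᵢ)` of representable presheaves, taken over small filtered categories. -/
def isInd (C : Type u) [SmallCategory C] [Preadditive C] :
    ObjectProperty (Cᵒᵖ ⥤ AddCommGrpCat.{u}) := fun F =>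
  ∃ (I : Type u) (_ : SmallCategory I) (_ : IsFiltered I) (X : I ⥤ C)
    (ι : X ⋙ preadditiveYoneda ⟶ (Functor.const I).obj F), Nonempty (IsColimit (Cocone.mk F ι))

/-- The ind-completion of a small additive category `C`, as a full subcategory of the category
of presheaves of abelian groups on `C` (all its objects are additive functors). -/
abbrev IndCompletion (C : Type u) [SmallCategory C] [Preadditive C] :=
  (isInd C).FullSubcategory

/-- Restriction of a section of `F` along `f`. -/
def res (F : Cᵒᵖ ⥤ AddCommGrpCat.{u}) {X Y : C} (f : X ⟶ Y) :
    F.obj (op Y) →+ F.obj (op X) := (F.map f.op).hom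

section

variable (F : Cᵒᵖ ⥤ AddCommGrpCat.{u})

lemma res_id {X : C} (x : F.obj (op X)) : res F (𝟙 X) x = x := by simp [res]

lemma res_comp {X Y Z : C} (f : X ⟶ Y) (g : Y ⟶ Z) (x : F.obj (op Z)) :
    res F (f ≫ g) x = res F f (res F g x) := by simp [res]

lemma res_add_hom [F.Additive] {X Y : C} (f g : X ⟶ Y) (x : F.obj (op Y)) :
    res F (f + g) x = res F f x + res F g x := by simp [res]

lemma res_zero_hom [F.Additive] {X Y : C} (x : F.obj (op Y)) :
    res F (0 : X ⟶ Y) x = 0 := by simp [res]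

lemma res_sub_hom [F.Additive] {X Y : C} (f g : X ⟶ Y) (x : F.obj (op Y)) :
    res F (f - g) x = res F f x - res F g x := by simp [res]

variable {F}

lemma app_res {G : Cᵒᵖ ⥤ AddCommGrpCat.{u}} (φ : F ⟶ G) {X Y : C} (f : X ⟶ Y)
    (x : F.obj (op Y)) : φ.app (op X) (res F f x) = res G f (φ.app (op Y) x) :=
  NatTrans.naturality_apply φ f.op x

lemma additive_of_res (h : ∀ {X Y : C} (f g : X ⟶ Y) (x : F.obj (op Y)),
    res F (f + g) x = res F f x + res F g x) : F.Additive where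
  map_add {X Y f g} := by
    ext x
    exact h f.unop g.unop x

end

/-- The elementary criterion for an additive presheaf to be flat. -/
def IsFlatPsh (F : Cᵒᵖ ⥤ AddCommGrpCat.{u}) : Prop :=
  F.Additive ∧ ∀ {X Y : C} (f : X ⟶ Y) (y : F.obj (op Y)), res F f y = 0 →
    ∃ (Z : C) (g : Y ⟶ Z) (z : F.obj (op Z)), f ≫ g = 0 ∧ res F g z = y

lemma isFlatPsh_of_isInd {F : Cᵒᵖ ⥤ AddCommGrpCat.{u}} (hF : isInd C F) : IsFlatPsh F := by
  obtain ⟨I, _, _, D, ι, ⟨hc⟩⟩ := hF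
  have hev (X : C) := isColimitOfPreserves ((evaluation _ AddCommGrpCat.{u}).obj (op X)) hc
  let j (i : I) (X : C) : (X ⟶ D.obj i) →+ F.obj (op X) := ((ι.app i).app (op X)).hom
  have hj (i : I) {X Y : C} (f : X ⟶ Y) (φ : Y ⟶ D.obj i) :
      res F f (j i Y φ) = j i X (f ≫ φ) := (app_res (ι.app i) f φ).symm
  have hrep {X : C} (x : F.obj (op X)) : ∃ i φ, j i X φ = x :=
    Concrete.isColimit_exists_rep _ (hev X) x
  have hw {i k : I} (a : i ⟶ k) {X : C} (φ : X ⟶ D.obj i) : j k X (φ ≫ D.map a) = j i X φ := by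
    have := congrArg (fun t => t.app (op X)) (ι.naturality a)
    exact (ConcreteCategory.congr_hom this φ).trans rfl
  have heq {i k : I} {X : C} (φ : X ⟶ D.obj i) (ψ : X ⟶ D.obj k) (h : j i X φ = j k X ψ) :
      ∃ (l : I) (a : i ⟶ l) (b : k ⟶ l), φ ≫ D.map a = ψ ≫ D.map b :=
    Concrete.isColimit_exists_of_rep_eq _ (hev X) φ ψ h
  refine ⟨additive_of_res fun f g x => ?_, fun {X Y} f y hy => ?_⟩
  · obtain ⟨i, φ, rfl⟩ := hrep x
    simp only [hj, Preadditive.add_comp, map_add]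
  · obtain ⟨i, φ, rfl⟩ := hrep y
    rw [hj] at hy
    obtain ⟨l, a, b, h⟩ := heq (f ≫ φ) (0 : X ⟶ D.obj i) (by rw [hy, map_zero])
    refine ⟨D.obj l, φ ≫ D.map a, j l _ (𝟙 _), by simpa using h, ?_⟩
    rw [hj, Category.comp_id, hw]

/-- The category of elements of a presheaf of abelian groups. -/
structure El (F : Cᵒᵖ ⥤ AddCommGrpCat.{u}) : Type u where
  X : C
  x : F.obj (op X)

instance (F : Cᵒᵖ ⥤ AddCommGrpCat.{u}) : SmallCategory (El F) where
  Hom p q := {f : p.X ⟶ q.X // res F f q.x = p.x}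
  id p := ⟨𝟙 _, res_id F _⟩
  comp f g := ⟨f.1 ≫ g.1, by rw [res_comp, g.2, f.2]⟩

lemma El.comp_val {F : Cᵒᵖ ⥤ AddCommGrpCat.{u}} {p q r : El F} (f : p ⟶ q) (g : q ⟶ r) :
    (f ≫ g).1 = f.1 ≫ g.1 := rfl

/-- The projection from the category of elements. -/
def El.proj (F : Cᵒᵖ ⥤ AddCommGrpCat.{u}) : El F ⥤ C where
  obj p := p.X
  map f := f.1

/-- The cocone over the category of elements. -/
def El.ι (F : Cᵒᵖ ⥤ AddCommGrpCat.{u}) [F.Additive] :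
    El.proj F ⋙ preadditiveYoneda ⟶ (Functor.const _).obj F where
  app p :=
    { app := fun W => AddCommGrpCat.ofHom
        (AddMonoidHom.mk' (fun φ : W.unop ⟶ p.X => res F φ p.x) (fun a b => res_add_hom F a b _))
      naturality := fun V W f => by
        ext φ
        exact res_comp F f.unop φ p.x }
  naturality p q f := by
    ext W φ
    exact (res_comp F φ f.1 q.x).trans (congrArg (res F φ) f.2)

lemma El.isFiltered [HasFiniteBiproducts C] {F : Cᵒᵖ ⥤ AddCommGrpCat.{u}} (hF : IsFlatPsh F) :
    IsFiltered (El F) := by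
  have := hF.1
  have : HasBinaryBiproducts C := hasBinaryBiproducts_of_finite_biproducts C
  exact
    { cocone_objs := fun p q => ⟨⟨p.X ⊞ q.X, res F biprod.fst p.x + res F biprod.snd q.x⟩,
        ⟨biprod.inl, by simp [← res_comp, res_zero_hom, res_id]⟩,
        ⟨biprod.inr, by simp [← res_comp, res_zero_hom, res_id]⟩, trivial⟩
      cocone_maps := fun p q f g => by
        obtain ⟨Z, h, z, h0, hz⟩ := hF.2 (f.1 - g.1) q.x (by rw [res_sub_hom, f.2, g.2, sub_self])
        refine ⟨⟨Z, z⟩, ⟨h, hz⟩, Subtype.ext ?_⟩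
        change f.1 ≫ h = g.1 ≫ h
        rwa [Preadditive.sub_comp, sub_eq_zero] at h0
      nonempty := ⟨⟨(HasZeroObject.zero (C := C)).choose, 0⟩⟩ }

/-- The component of a cocone over the category of elements. -/
def El.comp {F : Cᵒᵖ ⥤ AddCommGrpCat.{u}} (s : Cocone (El.proj F ⋙ preadditiveYoneda)) (p : El F)
    (X : C) : (X ⟶ p.X) →+ s.pt.obj (op X) :=
  ((s.ι.app p).app (op X)).hom

lemma El.comp_res {F : Cᵒᵖ ⥤ AddCommGrpCat.{u}} (s : Cocone (El.proj F ⋙ preadditiveYoneda))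
    (p : El F) {W V : C} (f : W ⟶ V) (φ : V ⟶ p.X) :
    res s.pt f (El.comp s p V φ) = El.comp s p W (f ≫ φ) :=
  (app_res (s.ι.app p) f φ).symm

lemma El.comp_hom {F : Cᵒᵖ ⥤ AddCommGrpCat.{u}} (s : Cocone (El.proj F ⋙ preadditiveYoneda))
    {p q : El F} (f : p.X ⟶ q.X) (hf : res F f q.x = p.x) :
    El.comp s q p.X f = El.comp s p p.X (𝟙 p.X) := by
  have := congrArg (fun t => t.app (op p.X)) (s.ι.naturality (X := p) (Y := q) ⟨f, hf⟩)
  have h : El.comp s q p.X (𝟙 p.X ≫ f) = El.comp s p p.X (𝟙 p.X) :=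
    ConcreteCategory.congr_hom this (𝟙 p.X)
  rwa [Category.id_comp] at h

lemma El.comp_add [HasBinaryBiproducts C] {F : Cᵒᵖ ⥤ AddCommGrpCat.{u}} [F.Additive]
    (s : Cocone (El.proj F ⋙ preadditiveYoneda)) {X : C} (x y : F.obj (op X)) :
    El.comp s ⟨X, x + y⟩ X (𝟙 X) = El.comp s ⟨X, x⟩ X (𝟙 X) + El.comp s ⟨X, y⟩ X (𝟙 X) := by
  have hl : res F biprod.inl (res F (biprod.fst : X ⊞ X ⟶ X) x +
      res F (biprod.snd : X ⊞ X ⟶ X) y) = x := by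
    simp [← res_comp, res_zero_hom, res_id]
  have hr : res F biprod.inr (res F (biprod.fst : X ⊞ X ⟶ X) x +
      res F (biprod.snd : X ⊞ X ⟶ X) y) = y := by
    simp [← res_comp, res_zero_hom, res_id]
  let r : El F := ⟨X ⊞ X, res F biprod.fst x + res F biprod.snd y⟩
  have h₁ := El.comp_hom s (p := ⟨X, x⟩) (q := r) biprod.inl hl
  have h₂ := El.comp_hom s (p := ⟨X, y⟩) (q := r) biprod.inr hr
  have h₃ := El.comp_hom s (p := ⟨X, x + y⟩) (q := r) (biprod.inl + biprod.inr)
    ((res_add_hom F _ _ _).trans (congrArg₂ (· + ·) hl hr))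
  exact h₃.symm.trans ((map_add _ _ _).trans (congrArg₂ (· + ·) h₁ h₂))

/-- The cocone over the category of elements is a colimit. -/
def El.isColimit [HasBinaryBiproducts C] (F : Cᵒᵖ ⥤ AddCommGrpCat.{u}) [F.Additive] :
    IsColimit (Cocone.mk F (El.ι F)) where
  desc s :=
    { app := fun X => AddCommGrpCat.ofHom (AddMonoidHom.mk'
        (fun x : F.obj X => El.comp s ⟨X.unop, x⟩ X.unop (𝟙 X.unop)) (fun x y => El.comp_add s x y))
      naturality := fun X Y f => by
        ext x
        change El.comp s ⟨Y.unop, res F f.unop x⟩ Y.unop (𝟙 Y.unop) =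
          res s.pt f.unop (El.comp s ⟨X.unop, x⟩ X.unop (𝟙 X.unop))
        rw [El.comp_res, Category.comp_id]
        exact (El.comp_hom s (p := ⟨Y.unop, res F f.unop x⟩) (q := ⟨X.unop, x⟩) f.unop rfl).symm }
  fac s p := by
    ext W φ
    exact (El.comp_hom s (p := ⟨W.unop, res F φ p.x⟩) (q := p) φ rfl).symm
  uniq s m hm := by
    ext X x
    have := congrArg (fun t => t.app X) (hm ⟨X.unop, x⟩)
    have h := ConcreteCategory.congr_hom this (𝟙 X.unop)
    change m.app X (res F (𝟙 X.unop) x) = _ at h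
    rw [res_id] at h
    exact h

lemma isInd_iff_isFlatPsh [HasFiniteBiproducts C] (F : Cᵒᵖ ⥤ AddCommGrpCat.{u}) :
    isInd C F ↔ IsFlatPsh F := by
  refine ⟨isFlatPsh_of_isInd, fun hF => ?_⟩
  have := hF.1
  have : HasBinaryBiproducts C := hasBinaryBiproducts_of_finite_biproducts C
  exact ⟨El F, inferInstance, El.isFiltered hF, El.proj F, El.ι F, ⟨El.isColimit F⟩⟩

end Ind


namespace ExactStructure

section

variable {A : Type u} [Category.{v} A] [Preadditive A] (E : ExactStructure A)

lemma conflation_pullback {K W Z Y : A} {κ : K ⟶ W} {d : W ⟶ Z} {w : κ ≫ d = 0}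
    (h : E.conflation (ShortComplex.mk κ d w)) (g : Y ⟶ Z) :
    ∃ (P : A) (b : P ⟶ W) (d' : P ⟶ Y) (κ' : K ⟶ P) (w' : κ' ≫ d' = 0),
      IsPullback b d' d g ∧ κ' ≫ b = κ ∧ E.conflation (ShortComplex.mk κ' d' w') := by
  obtain ⟨P, b, d', sq, hd'⟩ := E.deflation_pullback d g ⟨K, κ, w, h⟩
  obtain ⟨⟨hK⟩, -⟩ := E.isKernelCokernelPair _ h
  have hw : κ ≫ d = 0 ≫ g := by rw [w, zero_comp]
  have hm : Mono κ := mono_of_isLimit_fork hK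
  refine ⟨P, b, d', sq.lift κ 0 hw, sq.lift_snd _ _ _, sq, sq.lift_fst _ _ _,
    E.conflation_of_deflation _ _ _ hd' ⟨?_⟩⟩
  have : Mono (sq.lift κ 0 hw) := mono_of_mono_fac (sq.lift_fst κ 0 hw)
  refine KernelFork.IsLimit.ofι' _ _ fun {T} k hk => ?_
  have hk' : (k ≫ b) ≫ d = 0 := by rw [Category.assoc, sq.w, reassoc_of% hk, zero_comp]
  obtain ⟨l, hl⟩ := KernelFork.IsLimit.lift' hK (k ≫ b) hk'
  refine ⟨l, sq.hom_ext ?_ ?_⟩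
  · rw [Category.assoc, sq.lift_fst]; exact hl
  · rw [Category.assoc, sq.lift_snd, comp_zero, hk]

lemma inflation_inl [HasBinaryBiproducts A] (K Q : A) :
    IsInflation E.conflation (biprod.inl : K ⟶ K ⊞ Q) := by
  obtain ⟨X, i, w, h⟩ := E.deflation_id Q
  obtain ⟨⟨hK⟩, -⟩ := E.isKernelCokernelPair _ h
  have hi : i = 0 := by simpa using w
  have hX : 𝟙 X = 0 := by
    have : Mono i := mono_of_isLimit_fork hK
    rw [← cancel_mono i, hi, comp_zero, comp_zero]
  obtain ⟨Y, f, i', sq, hi'⟩ := E.inflation_pushout i (0 : X ⟶ K) ⟨Q, 𝟙 Q, w, h⟩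
  have h0 {T : A} (a b : X ⟶ T) : a = b := by
    rw [← Category.id_comp a, ← Category.id_comp b, hX, zero_comp, zero_comp]
  have sq' : IsPushout i (0 : X ⟶ K) (biprod.inr : Q ⟶ K ⊞ Q) biprod.inl :=
    ⟨⟨h0 _ _⟩, ⟨PushoutCocone.IsColimit.mk _ (fun s => biprod.desc s.inr s.inl)
      (fun s => by simp) (fun s => by simp)
      (fun s m h h' => by ext <;> simp [h, h'])⟩⟩
  exact E.inflation_of_iso hi' (sq.isoIsPushout _ _ sq') _ (by simp)

lemma inflation_biprod_lift [HasBinaryBiproducts A] {K W Q : A} {κ : K ⟶ W}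
    (hκ : IsInflation E.conflation κ) (k : K ⟶ Q) :
    IsInflation E.conflation (biprod.lift κ k) := by
  obtain ⟨Y, f, i', sq, hi'⟩ := E.inflation_pushout κ (biprod.inl : K ⟶ K ⊞ Q) hκ
  have sq' : IsPushout κ (biprod.inl : K ⟶ K ⊞ Q) (biprod.inl : W ⟶ W ⊞ Q)
      (biprod.map κ (𝟙 Q)) :=
    ⟨⟨by simp⟩, ⟨PushoutCocone.IsColimit.mk _ (fun s => biprod.desc s.inl (biprod.inr ≫ s.inr))
      (fun s => by simp) (fun s => by ext <;> simp [s.condition])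
      (fun s m h h' => by
        ext
        · simp [h]
        · simp [← h'])⟩⟩
  have h1 := E.inflation_of_iso hi' (sq.isoIsPushout _ _ sq') (biprod.map κ (𝟙 Q)) (by simp)
  have h2 := E.inflation_of_iso (E.inflation_inl K Q) (Biprod.unipotentUpper k)
    (biprod.lift (𝟙 K) k) (by ext <;> simp)
  have := E.inflation_comp _ _ h2 h1
  have e : biprod.lift (𝟙 K) k ≫ biprod.map κ (𝟙 Q) = biprod.lift κ k := by ext <;> simp
  rwa [e] at this

end

end ExactStructure

section Lex

variable {C : Type u} [SmallCategory C] [Preadditive C] (E : ExactStructure C)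

/-- The left exact functors on the exact category `(C, E)`: additive functors `F : Cᵒᵖ ⥤ Ab` such
that `0 ⟶ F Z ⟶ F Y ⟶ F X` is exact for all conflations `X ⟶ Y ⟶ Z`. -/
def isLex : ObjectProperty (Cᵒᵖ ⥤ AddCommGrpCat.{u}) := fun F =>
  F.Additive ∧ ∀ S : ShortComplex C, E.conflation S →
    Function.Injective (F.map S.g.op) ∧ Function.Exact (F.map S.g.op) (F.map S.f.op)

/-- The category `Lex((C, E)ᵒᵖ, Ab)` of left exact functors on the exact category `(C, E)`. -/
abbrev LexCategory := (isLex E).FullSubcategory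

variable {E}

lemma isLex_inj {F : Cᵒᵖ ⥤ AddCommGrpCat.{u}} (hF : isLex E F) {Y Z : C} {d : Y ⟶ Z}
    (hd : IsDeflation E.conflation d) {x y : F.obj (op Z)} (h : res F d x = res F d y) :
    x = y := by
  obtain ⟨X, i, w, hi⟩ := hd
  exact (hF.2 _ hi).1 h

lemma isLex_glue {F : Cᵒᵖ ⥤ AddCommGrpCat.{u}} (hF : isLex E F) {X Y Z : C} {i : X ⟶ Y}
    {d : Y ⟶ Z} {w : i ≫ d = 0} (h : E.conflation (ShortComplex.mk i d w)) (y : F.obj (op Y))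
    (hy : res F i y = 0) : ∃ z, res F d z = y :=
  ((hF.2 _ h).2 y).1 hy

lemma isLex_mk {F : Cᵒᵖ ⥤ AddCommGrpCat.{u}} (hadd : F.Additive)
    (hinj : ∀ {Y Z : C} (d : Y ⟶ Z), IsDeflation E.conflation d → ∀ z, res F d z = 0 → z = 0)
    (hglue : ∀ {X Y Z : C} (i : X ⟶ Y) (d : Y ⟶ Z) (w : i ≫ d = 0),
      E.conflation (ShortComplex.mk i d w) → ∀ y, res F i y = 0 → ∃ z, res F d z = y) :
    isLex E F := by
  refine ⟨hadd, fun S hS => ⟨?_, fun y => ⟨fun hy => hglue S.f S.g S.zero hS y hy, ?_⟩⟩⟩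
  · exact (injective_iff_map_eq_zero (res F S.g)).2 (hinj S.g ⟨_, _, S.zero, hS⟩)
  · rintro ⟨z, rfl⟩
    change res F S.f (res F S.g z) = 0
    rw [← res_comp, S.zero, res_zero_hom]

lemma isLex_of_isFlatPsh {F : Cᵒᵖ ⥤ AddCommGrpCat.{u}} (hF : IsFlatPsh F) : isLex E F := by
  have := hF.1
  refine isLex_mk hF.1 (fun {Y Z} d hd z hz => ?_) fun {X Y Z} i d w h y hy => ?_
  · obtain ⟨X, i, w, h⟩ := hd
    obtain ⟨-, ⟨hc⟩⟩ := E.isKernelCokernelPair _ h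
    obtain ⟨T, g, t, hg, rfl⟩ := hF.2 d z hz
    have : Epi d := epi_of_isColimit_cofork hc
    rw [show g = 0 by rw [← cancel_epi d, hg, comp_zero], res_zero_hom]
  · obtain ⟨-, ⟨hc⟩⟩ := E.isKernelCokernelPair _ h
    obtain ⟨T, g, t, hg, rfl⟩ := hF.2 i y hy
    obtain ⟨l, hl⟩ := CokernelCofork.IsColimit.desc' hc g hg
    have hl' : d ≫ l = g := hl
    exact ⟨res F l t, by rw [← res_comp, hl']⟩

lemma isInd_le_isLex (E : ExactStructure C) : isInd C ≤ isLex E :=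
  fun _ hF => isLex_of_isFlatPsh (isFlatPsh_of_isInd hF)

/-- The inclusion of the ind-completion into the category of left exact functors. -/
abbrev indToLex (E : ExactStructure C) : IndCompletion C ⥤ LexCategory E :=
  ObjectProperty.ιOfLE (isInd_le_isLex E)

instance (E : ExactStructure C) : (indToLex E).Additive where

/-- The short exact sequences of the ind-completion of the exact category `(C, E)`: sequences in
the ind-completion of `C` which are short exact (i.e. kernel-cokernel pairs) in the abelian
category of left exact functors on `(C, E)`. -/
def indConflation (E : ExactStructure C) : ObjectProperty (ShortComplex (IndCompletion C)) :=
  fun S => IsKernelCokernelPair (S.map (indToLex E))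

/-- The Grothendieck topology generated by the deflations. -/
def topology (E : ExactStructure C) : GrothendieckTopology C where
  sieves X := {S | ∃ (Y : C) (d : Y ⟶ X), IsDeflation E.conflation d ∧ S d}
  top_mem' X := ⟨X, 𝟙 X, E.deflation_id X, trivial⟩
  pullback_stable' X Y S f := by
    rintro ⟨Z, d, hd, hS⟩
    obtain ⟨P, f', d', sq, hd'⟩ := E.deflation_pullback d f hd
    refine ⟨P, d', hd', ?_⟩
    change S (d' ≫ f)
    rw [← sq.w]
    exact S.downward_closed hS f'
  transitive' X S := by
    rintro ⟨Y, d, hd, hS⟩ R hR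
    obtain ⟨Z, e, he, hRe⟩ := hR hS
    exact ⟨Z, e ≫ d, E.deflation_comp e d he hd, hRe⟩

lemma isSheaf_of_isLex {F : Cᵒᵖ ⥤ AddCommGrpCat.{u}} (hF : isLex E F) :
    Presheaf.IsSheaf (topology E) F := by
  have := hF.1
  rw [Presheaf.isSheaf_iff_isSheaf_forget (topology E) F (forget AddCommGrpCat.{u}),
    isSheaf_iff_isSheaf_of_type]
  rintro X S ⟨Y, d, hd, hS⟩ x hx
  have hd' := hd
  obtain ⟨K, i, w, hi⟩ := hd'
  let x' {Z : C} (f : Z ⟶ X) (hf : S f) : F.obj (op Z) := x f hf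
  have hx' {Z W : C} (f : Z ⟶ X) (hf : S f) (g : W ⟶ Z) :
      res F g (x' f hf) = x' (g ≫ f) (S.downward_closed hf g) :=
    hx.to_sieveCompatible f g hf |>.symm
  have hc {Z : C} {f g : Z ⟶ X} (h : f = g) (hf : S f) (hg : S g) : x' f hf = x' g hg := by
    subst h; rfl
  obtain ⟨z, hz⟩ := isLex_glue hF hi (x' d hS) (by
    rw [← res_zero_hom F (X := K) (x' d hS), hx', hx']
    exact hc (by rw [w, zero_comp]) _ _)
  refine ⟨z, fun Z f hf => ?_, fun t ht => isLex_inj hF hd ((ht d hS).trans hz.symm)⟩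
  change res F f z = x' f hf
  obtain ⟨P, f', d', sq, hd'⟩ := E.deflation_pullback d f hd
  refine isLex_inj hF hd' ?_
  rw [← res_comp, ← sq.w, res_comp, hz, hx', hx']
  exact hc sq.w _ _

lemma isLex_of_isSheaf {F : Cᵒᵖ ⥤ AddCommGrpCat.{u}} (hadd : F.Additive)
    (hF : Presheaf.IsSheaf (topology E) F) : isLex E F := by
  rw [Presheaf.isSheaf_iff_isSheaf_forget (topology E) F (forget AddCommGrpCat.{u}),
    isSheaf_iff_isSheaf_of_type] at hF
  have key {Y Z : C} (d : Y ⟶ Z) (hd : IsDeflation E.conflation d) (x : F.obj (op Y))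
      (hx : ∀ {T : C} (p₁ p₂ : T ⟶ Y), p₁ ≫ d = p₂ ≫ d → res F p₁ x = res F p₂ x) :
      ∃! y, res F d y = x := by
    have h := hF (Sieve.generate (Presieve.singleton d))
      ⟨Y, d, hd, ⟨Y, 𝟙 _, d, Presieve.singleton_self d, by simp⟩⟩
    rw [← Presieve.isSheafFor_iff_generate, Presieve.isSheafFor_singleton] at h
    exact h x hx
  refine isLex_mk hadd (fun {Y Z} d hd z hz => ?_) fun {X Y Z} i d w h y hy => ?_
  · exact (key d hd 0 (by simp)).unique hz (by simp)
  · obtain ⟨⟨hK⟩, -⟩ := E.isKernelCokernelPair _ h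
    refine (key d ⟨X, i, w, h⟩ y fun {T} p₁ p₂ hp => ?_).exists
    obtain ⟨l, hl⟩ := KernelFork.IsLimit.lift' hK (p₁ - p₂) (by
      change (p₁ - p₂) ≫ d = 0
      rw [Preadditive.sub_comp, hp, sub_self])
    have hl' : l ≫ i = p₁ - p₂ := hl
    rw [← sub_eq_zero, ← res_sub_hom, ← hl', res_comp, hy, map_zero]

end Lex


section Coherent

variable {C : Type u} [SmallCategory C] [Preadditive C] (E : ExactStructure C)

/-- `0 ⟶ F ⟶ G ⟶ H` is exact and `G ⟶ H` is locally surjective for the deflations of `E`. -/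
structure LocExact {F G H : Cᵒᵖ ⥤ AddCommGrpCat.{u}} (i : F ⟶ G) (p : G ⟶ H) : Prop where
  zero : ∀ (X : C) (a : F.obj (op X)), p.app (op X) (i.app (op X) a) = 0
  inj : ∀ (X : C) (a : F.obj (op X)), i.app (op X) a = 0 → a = 0
  exact : ∀ (X : C) (g : G.obj (op X)), p.app (op X) g = 0 → ∃ a, i.app (op X) a = g
  surj : ∀ (X : C) (h : H.obj (op X)), ∃ (W : C) (d : W ⟶ X) (w : G.obj (op W)),
    IsDeflation E.conflation d ∧ p.app (op W) w = res H d h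

variable {E}

lemma LocExact.exists_lift {F G H K : Cᵒᵖ ⥤ AddCommGrpCat.{u}} {i : F ⟶ G} {p : G ⟶ H}
    (h : LocExact E i p) (k : K ⟶ G) (hk : k ≫ p = 0) : ∃ l : K ⟶ F, l ≫ i = k := by
  have hi (X : C) : Function.Injective (i.app (op X)) :=
    (injective_iff_map_eq_zero (i.app (op X)).hom).2 (h.inj X)
  have hex (X : C) (x : K.obj (op X)) : ∃ a, i.app (op X) a = k.app (op X) x :=
    h.exact X _ (by
      have := ConcreteCategory.congr_hom (congrArg (fun t => t.app (op X)) hk) x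
      exact this)
  choose l hl using hex
  refine ⟨{ app := fun X => AddCommGrpCat.ofHom (AddMonoidHom.mk' (l X.unop) fun a b => hi _ ?_)
            naturality := fun X Y f => ?_ }, ?_⟩
  · rw [hl]
    refine (map_add (k.app X).hom a b).trans ((congrArg₂ (· + ·) (hl _ a).symm
      (hl _ b).symm).trans (map_add (i.app X).hom _ _).symm)
  · ext x
    refine hi Y.unop ?_
    change i.app Y (l Y.unop (res K f.unop x)) = i.app Y (res F f.unop (l X.unop x))
    refine (hl _ _).trans ((app_res k f.unop x).trans
      (Eq.trans ?_ (app_res i f.unop (l X.unop x)).symm))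
    exact congrArg _ (hl X.unop x).symm
  · ext X x
    exact hl X.unop x

lemma locExact_of_shortExact {S : ShortComplex (Sheaf (topology E) AddCommGrpCat.{u})}
    (hS : S.ShortExact) : LocExact E S.f.hom S.g.hom := by
  have hm := hS.mono_f
  have he := hS.epi_g
  let ev (X : C) : Sheaf (topology E) AddCommGrpCat.{u} ⥤ AddCommGrpCat.{u} :=
    sheafToPresheaf _ _ ⋙ (evaluation _ _).obj (op X)
  have hpl (X : C) : PreservesLimitsOfSize.{0, 0} (ev X) := inferInstance
  have hz (X : C) : (ev X).PreservesZeroMorphisms := ⟨fun _ _ => rfl⟩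
  refine ⟨fun X a => ?_, fun X a ha => ?_, fun X g hg => ?_, fun X h => ?_⟩
  · exact ConcreteCategory.congr_hom (congrArg (fun t => t.hom.app (op X)) S.zero) a
  · have : Mono ((ev X).map S.f) := inferInstance
    rw [AddCommGrpCat.mono_iff_injective] at this
    exact this (ha.trans (map_zero ((ev X).map S.f).hom).symm)
  · have := hS.exact.map_of_mono_of_preservesKernel (ev X) hm inferInstance
    exact (ShortComplex.ab_exact_iff _).1 this g hg
  · rw [← Sheaf.isLocallySurjective_iff_epi'] at he
    obtain ⟨W, d, hd, w, hw⟩ := he.imageSieve_mem h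
    exact ⟨W, d, w, hd, hw⟩

lemma LocExact.shortExact {S : ShortComplex (Sheaf (topology E) AddCommGrpCat.{u})}
    (h : LocExact E S.f.hom S.g.hom) : S.ShortExact := by
  have hm : Mono S.f := by
    refine (sheafToPresheaf _ _).mono_of_mono_map (f := S.f) ?_
    have (X : Cᵒᵖ) : Mono (((sheafToPresheaf _ _).map S.f).app X) := by
      rw [AddCommGrpCat.mono_iff_injective]
      exact (injective_iff_map_eq_zero (S.f.hom.app X).hom).2 (h.inj X.unop)
    exact NatTrans.mono_of_mono_app _
  refine { exact := ?_, mono_f := hm, epi_g := ?_ }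
  · refine ShortComplex.exact_of_f_is_kernel _ (KernelFork.IsLimit.ofι' _ _ fun {T} k hk => ?_)
    have := h.exists_lift k.hom (congrArg (fun t => t.hom) hk)
    exact ⟨ObjectProperty.homMk this.choose, ObjectProperty.hom_ext _ this.choose_spec⟩
  · rw [← Sheaf.isLocallySurjective_iff_epi']
    refine ⟨fun {X} s => ?_⟩
    obtain ⟨W, d, w, hd, hw⟩ := h.surj X s
    exact ⟨W, d, hd, w, hw⟩

lemma LocExact.additive [HasBinaryBiproducts C] {F G H : Cᵒᵖ ⥤ AddCommGrpCat.{u}} {i : F ⟶ G}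
    {p : G ⟶ H} (h : LocExact E i p) (hF : F.Additive) (hH : H.Additive) : G.Additive := by
  have h0 {X Y : C} (y : G.obj (op Y)) : res G (0 : X ⟶ Y) y = 0 := by
    have hp : p.app (op X) (res G (0 : X ⟶ Y) y) = 0 := by rw [app_res, res_zero_hom]
    obtain ⟨a, ha⟩ := h.exact X _ hp
    have h1 : res G (0 : X ⟶ X) (res G (0 : X ⟶ Y) y) = res G (0 : X ⟶ Y) y := by
      rw [← res_comp, zero_comp]
    rw [← h1, ← ha, ← app_res, res_zero_hom]
    exact map_zero (i.app (op X)).hom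
  have key {Y : C} (y : G.obj (op Y)) : res G (biprod.fst + biprod.snd : Y ⊞ Y ⟶ Y) y
      - res G biprod.fst y - res G biprod.snd y = 0 := by
    obtain ⟨a, ha⟩ := h.exact (Y ⊞ Y) (res G (biprod.fst + biprod.snd : Y ⊞ Y ⟶ Y) y
      - res G biprod.fst y - res G biprod.snd y) (by
        refine ((map_sub (p.app _).hom _ _).trans
          (congrArg (· - _) (map_sub (p.app _).hom _ _))).trans ?_
        refine Eq.trans (congrArg₂ (· - ·) (congrArg₂ (· - ·) (app_res p _ y) (app_res p _ y))
          (app_res p _ y)) ?_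
        rw [res_add_hom]
        abel)
    have hl : res F biprod.inl a = 0 := h.inj _ _ (by
      rw [app_res, ha, map_sub, map_sub, ← res_comp, ← res_comp, ← res_comp]
      simp [h0])
    have hr : res F biprod.inr a = 0 := h.inj _ _ (by
      rw [app_res, ha, map_sub, map_sub, ← res_comp, ← res_comp, ← res_comp]
      simp [h0])
    have ha0 : a = 0 := by
      rw [← res_id F a, ← biprod.total, res_add_hom, res_comp, res_comp, hl, hr, map_zero,
        map_zero, add_zero]
    rw [← ha, ha0]
    exact map_zero (i.app _).hom
  refine additive_of_res fun {X Y} f g y => ?_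
  have := congrArg (res G (biprod.lift f g)) (key y)
  rw [map_sub, map_sub, ← res_comp, ← res_comp, ← res_comp, map_zero] at this
  simp only [Preadditive.comp_add, biprod.lift_fst, biprod.lift_snd] at this
  rw [sub_sub, sub_eq_zero] at this
  exact this

lemma LocExact.isFlatPsh [HasBinaryBiproducts C] {F G H : Cᵒᵖ ⥤ AddCommGrpCat.{u}} {i : F ⟶ G}
    {p : G ⟶ H} (h : LocExact E i p) (hF : IsFlatPsh F) (hH : IsFlatPsh H)
    (hG : Presheaf.IsSheaf (topology E) G) : IsFlatPsh G := by
  have hFa := hF.1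
  have hHa := hH.1
  have hGa := h.additive hF.1 hH.1
  have hGl : isLex E G := isLex_of_isSheaf hGa hG
  refine ⟨hGa, fun {X Y} f y hy => ?_⟩
  -- factor the image of `y` in `H`, and lift it locally to `G`
  obtain ⟨Z, g, z, hfg, hz⟩ := hH.2 f (p.app (op Y) y) (by
    rw [← app_res, hy]; exact map_zero (p.app _).hom)
  obtain ⟨W, d, t, hd, ht⟩ := h.surj Z z
  obtain ⟨K, κ, w, hκ⟩ := hd
  obtain ⟨P, b, d', κ', w', sq, hb, hκ'⟩ := E.conflation_pullback hκ g
  obtain ⟨a, ha⟩ := h.exact P (res G d' y - res G b t) (by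
    refine (map_sub (p.app _).hom _ _).trans
      (Eq.trans (congrArg₂ (· - ·) (app_res p d' y) (app_res p b t)) ?_)
    rw [ht, ← hz, ← res_comp, ← res_comp, sq.w, sub_self])
  -- the difference of the two lifts is a section of `F` killed by the lift of `f`
  have hf : (0 : X ⟶ W) ≫ d = f ≫ g := by rw [zero_comp, hfg]
  obtain ⟨Q, g', q, hfg', hq⟩ := hF.2 (sq.lift 0 f hf) a (h.inj _ _ (by
    rw [app_res, ha, map_sub, ← res_comp, ← res_comp, sq.lift_fst, sq.lift_snd, hy,
      res_zero_hom, sub_zero]))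
  -- glue the lift and the correction term
  obtain ⟨T, e, we, he⟩ := E.inflation_biprod_lift ⟨Z, d, w, hκ⟩ (κ' ≫ g')
  have hiq : i.app (op P) (res F g' q) = res G g' (i.app (op Q) q) := app_res i g' q
  obtain ⟨s, hs⟩ := isLex_glue hGl he
    (res G biprod.fst t + res G biprod.snd (i.app (op Q) q)) (by
      rw [map_add, ← res_comp, ← res_comp, biprod.lift_fst, biprod.lift_snd, res_comp, ← hiq, hq,
        ha, map_sub, ← res_comp, ← res_comp, hb, w', res_zero_hom]
      abel)
  have hbl {V : C} (k : V ⟶ P) : k ≫ biprod.lift b g' = biprod.lift (k ≫ b) (k ≫ g') := by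
    ext <;> simp
  have hbe : κ' ≫ biprod.lift b g' ≫ e = 0 := by
    rw [← Category.assoc, hbl, hb, we]
  obtain ⟨-, ⟨hc⟩⟩ := E.isKernelCokernelPair _ hκ'
  obtain ⟨v, hv⟩ := CokernelCofork.IsColimit.desc' hc _ hbe
  have hv' : d' ≫ v = biprod.lift b g' ≫ e := hv
  refine ⟨T, v, s, ?_, ?_⟩
  · rw [← sq.lift_snd 0 f hf, Category.assoc, hv', ← Category.assoc, hbl,
      sq.lift_fst, hfg']
    have : biprod.lift (0 : X ⟶ W) (0 : X ⟶ Q) = 0 := by ext <;> simp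
    rw [this, zero_comp]
  · refine isLex_inj hGl (d := d') ⟨K, κ', w', hκ'⟩ ?_
    rw [← res_comp, hv', res_comp, hs, map_add, ← res_comp, ← res_comp, biprod.lift_fst,
      biprod.lift_snd, ← hiq, hq, ha]
    abel

/-- The section of a presheaf corresponding to a morphism from a representable presheaf. -/
def ofSection {F : Cᵒᵖ ⥤ AddCommGrpCat.{u}} (hF : F.Additive) {X : C} (x : F.obj (op X)) :
    preadditiveYoneda.obj X ⟶ F where
  app W := AddCommGrpCat.ofHom
    (AddMonoidHom.mk' (fun φ : W.unop ⟶ X => res F φ x) (fun a b => res_add_hom F a b _))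
  naturality V W f := by
    ext φ
    exact res_comp F f.unop φ x

lemma ofSection_app {F : Cᵒᵖ ⥤ AddCommGrpCat.{u}} (hF : F.Additive) {X : C} (x : F.obj (op X))
    {W : C} (φ : W ⟶ X) : (ofSection hF x).app (op W) φ = res F φ x := rfl

lemma isFlatPsh_yoneda (X : C) : IsFlatPsh (preadditiveYoneda.obj X) := by
  have hr {V W : C} (f : V ⟶ W) (φ : W ⟶ X) :
      res (preadditiveYoneda.obj X) f φ = f ≫ φ := rfl
  refine ⟨additive_of_res fun {V W} f g (φ : W ⟶ X) => ?_, fun {V W} f (φ : W ⟶ X) h => ?_⟩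
  · exact (hr _ _).trans (Preadditive.add_comp _ _ _ _ _ _)
  · exact ⟨X, φ, 𝟙 X, (hr _ _).symm.trans h, (hr _ _).trans (Category.comp_id _)⟩

/-- The sections of `H` which are locally in the image of `p`. -/
def locImage {G H : Cᵒᵖ ⥤ AddCommGrpCat.{u}} (p : G ⟶ H) (X : C) :
    AddSubgroup (H.obj (op X)) where
  carrier := {h | ∃ (W : C) (d : W ⟶ X) (w : G.obj (op W)),
    IsDeflation E.conflation d ∧ p.app (op W) w = res H d h}
  zero_mem' := ⟨X, 𝟙 X, 0, E.deflation_id X,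
    (map_zero (p.app _).hom).trans (map_zero (res H _)).symm⟩
  neg_mem' := by
    rintro x ⟨W, d, w, hd, hw⟩
    exact ⟨W, d, -w, hd, (map_neg (p.app _).hom w).trans
      ((congrArg _ hw).trans (map_neg (res H d) x).symm)⟩
  add_mem' := by
    rintro x y ⟨W, d, w, hd, hw⟩ ⟨W', d', w', hd', hw'⟩
    obtain ⟨P, b, b', sq, hb'⟩ := E.deflation_pullback d d' hd
    refine ⟨P, b' ≫ d', res G b w + res G b' w', E.deflation_comp _ _ hb' hd', ?_⟩
    refine (map_add (p.app _).hom _ _).trans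
      (Eq.trans (congrArg₂ (· + ·) (app_res p b w) (app_res p b' w')) ?_)
    rw [hw, hw', ← res_comp, ← res_comp, sq.w, map_add]

lemma locImage_res {G H : Cᵒᵖ ⥤ AddCommGrpCat.{u}} (p : G ⟶ H) {X Y : C} (f : X ⟶ Y)
    (h : H.obj (op Y)) (hh : h ∈ locImage (E := E) p Y) :
    res H f h ∈ locImage (E := E) p X := by
  obtain ⟨W, d, w, hd, hw⟩ := hh
  obtain ⟨P, b, d', sq, hd'⟩ := E.deflation_pullback d f hd
  refine ⟨P, d', res G b w, hd', ?_⟩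
  rw [app_res, hw, ← res_comp, ← res_comp, sq.w]

/-- The presheaf of sections of `H` which are locally in the image of `p`. -/
def locImagePsh (E : ExactStructure C) {G H : Cᵒᵖ ⥤ AddCommGrpCat.{u}} (p : G ⟶ H) :
    Cᵒᵖ ⥤ AddCommGrpCat.{u} where
  obj X := AddCommGrpCat.of (locImage (E := E) p X.unop)
  map {X Y} f := AddCommGrpCat.ofHom
    (((res H f.unop).comp (locImage (E := E) p X.unop).subtype).codRestrict
      (locImage (E := E) p Y.unop) (fun x => locImage_res p f.unop x.1 x.2))
  map_id X := by
    ext x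
    exact res_id H (x : locImage (E := E) p _).1
  map_comp f g := by
    ext x
    exact res_comp H g.unop f.unop (x : locImage (E := E) p _).1

lemma locImagePsh_res {G H : Cᵒᵖ ⥤ AddCommGrpCat.{u}} (p : G ⟶ H) {X Y : C} (f : X ⟶ Y)
    (x : locImage (E := E) p Y) :
    res (locImagePsh E p) f x = ⟨res H f x.1, locImage_res p f x.1 x.2⟩ := rfl

lemma isLex_locImagePsh {G H : Cᵒᵖ ⥤ AddCommGrpCat.{u}} (p : G ⟶ H) (hH : isLex E H) :
    isLex E (locImagePsh E p) := by
  have := hH.1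
  refine isLex_mk (additive_of_res fun {X Y} f g (x : locImage (E := E) p Y) => ?_)
    (fun {Y Z} d hd (z : locImage (E := E) p Z) hz => ?_)
    fun {X Y Z} i d w h (y : locImage (E := E) p Y) hy => ?_
  · exact Subtype.ext (res_add_hom H f g x.1)
  · exact Subtype.ext (isLex_inj hH hd ((congrArg Subtype.val hz).trans (map_zero _).symm))
  · obtain ⟨z, hz⟩ := isLex_glue hH h y.1 (congrArg Subtype.val hy)
    obtain ⟨W, d', t, hd', ht⟩ := y.2
    exact ⟨(⟨z, W, d' ≫ d, t, E.deflation_comp _ _ hd' ⟨X, i, w, h⟩, by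
      rw [ht, ← hz, res_comp]⟩ : locImage (E := E) p Z), Subtype.ext hz⟩

lemma locExact_of_isKernelCokernelPair {S : ShortComplex (LexCategory E)}
    (hS : IsKernelCokernelPair S) : LocExact E S.f.hom S.g.hom := by
  obtain ⟨⟨hK⟩, ⟨hC⟩⟩ := hS
  have hm : Mono S.f := mono_of_isLimit_fork hK
  have he : Epi S.g := epi_of_isColimit_cofork hC
  have hF := S.X₁.property.1
  have hG := S.X₂.property.1
  have hH := S.X₃.property.1
  have hz (X : C) (a : S.X₁.obj.obj (op X)) :
      S.g.hom.app (op X) (S.f.hom.app (op X) a) = 0 :=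
    ConcreteCategory.congr_hom (congrArg (fun t => t.hom.app (op X)) S.zero) a
  let y (X : C) : LexCategory E := ⟨preadditiveYoneda.obj X, isLex_of_isFlatPsh (isFlatPsh_yoneda X)⟩
  let sec {T : LexCategory E} {X : C} (x : T.obj.obj (op X)) : y X ⟶ T :=
    ObjectProperty.homMk (ofSection T.property.1 x)
  have hsec {T : LexCategory E} {X : C} (x : T.obj.obj (op X)) :
      (sec x).hom.app (op X) (𝟙 X) = x := res_id _ x
  have hsec0 {T T' : LexCategory E} (φ : T ⟶ T') {X : C} (x : T.obj.obj (op X))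
      (hx : φ.hom.app (op X) x = 0) : sec x ≫ φ = 0 := by
    ext W ψ
    refine (app_res φ.hom ψ x).trans ?_
    rw [hx, map_zero]
    rfl
  refine ⟨hz, fun X a ha => ?_, fun X g hg => ?_, fun X h => ?_⟩
  · have : sec a = 0 := by
      rw [← cancel_mono S.f, hsec0 S.f a ha, zero_comp]
    rw [← hsec a, this]
    rfl
  · obtain ⟨l, hl⟩ := KernelFork.IsLimit.lift' hK (sec g) (hsec0 S.g g hg)
    refine ⟨l.hom.app (op X) (𝟙 X), ?_⟩
    have hl' : l ≫ S.f = sec g := hl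
    refine Eq.trans ?_ (hsec g)
    rw [← hl']
    rfl
  · let H' : LexCategory E := ⟨locImagePsh E S.g.hom, isLex_locImagePsh S.g.hom S.X₃.property⟩
    let j : H' ⟶ S.X₃ := ObjectProperty.homMk
      { app := fun X => AddCommGrpCat.ofHom (locImage (E := E) S.g.hom X.unop).subtype }
    let q : S.X₂ ⟶ H' := ObjectProperty.homMk
      { app := fun X => AddCommGrpCat.ofHom ((S.g.hom.app X).hom.codRestrict
          (locImage (E := E) S.g.hom X.unop)
          (fun w => ⟨X.unop, 𝟙 _, w, E.deflation_id _, (res_id _ _).symm⟩))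
        naturality := fun X Y f => by
          ext x
          exact Subtype.ext (app_res S.g.hom f.unop x) }
    have hqj : q ≫ j = S.g := rfl
    have hq0 : S.f ≫ q = 0 := by
      ext X x
      exact Subtype.ext (hz X.unop x)
    obtain ⟨l, hl⟩ := CokernelCofork.IsColimit.desc' hC q hq0
    have hl' : S.g ≫ l = q := hl
    have hlj : (show S.X₃ ⟶ H' from l) ≫ j = 𝟙 S.X₃ := by
      rw [← cancel_epi S.g, reassoc_of% hl', hqj, Category.comp_id]
    have hh : (l.hom.app (op X) h : locImage (E := E) S.g.hom X).1 = h :=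
      ConcreteCategory.congr_hom (congrArg (fun t => t.hom.app (op X)) hlj) h
    have := (l.hom.app (op X) h : locImage (E := E) S.g.hom X).2
    rw [hh] at this
    exact this

/-- The inclusion of the left exact functors into the sheaves. -/
abbrev lexToSheaf (E : ExactStructure C) :
    LexCategory E ⥤ Sheaf (topology E) AddCommGrpCat.{u} :=
  ObjectProperty.ιOfLE (fun _ h => isSheaf_of_isLex h)

instance (E : ExactStructure C) : (lexToSheaf E).Additive where

/-- The inclusion of the ind-completion into the sheaves. -/
abbrev indToSheaf (E : ExactStructure C) :
    IndCompletion C ⥤ Sheaf (topology E) AddCommGrpCat.{u} :=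
  indToLex E ⋙ lexToSheaf E

lemma isKernelCokernelPair_iff {S : ShortComplex (LexCategory E)} :
    IsKernelCokernelPair S ↔ LocExact E S.f.hom S.g.hom :=
  ⟨locExact_of_isKernelCokernelPair, fun h =>
    isKernelCokernelPair_of_map_shortExact (lexToSheaf E) S
      (LocExact.shortExact (S := S.map (lexToSheaf E)) h)⟩

/-- A concrete description of the short exact sequences of the ind-completion. -/
lemma indConflation_iff (S : ShortComplex (IndCompletion C)) :
    indConflation E S ↔ LocExact E S.f.hom S.g.hom :=
  isKernelCokernelPair_iff

lemma indConflation_eq (E : ExactStructure C) :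
    indConflation E = fun S => (S.map (indToSheaf E)).ShortExact := by
  ext S
  rw [indConflation_iff]
  exact ⟨fun h => LocExact.shortExact (S := S.map (indToSheaf E)) h,
    fun h => locExact_of_shortExact h⟩

lemma isInd_of_iso {F G : Cᵒᵖ ⥤ AddCommGrpCat.{u}} (e : F ≅ G) (hF : isInd C F) : isInd C G := by
  obtain ⟨I, _, _, X, ι, ⟨h⟩⟩ := hF
  exact ⟨I, inferInstance, inferInstance, X, ι ≫ (Functor.const I).map e.hom,
    ⟨h.ofIsoColimit (Cocone.ext e (fun j => rfl))⟩⟩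

/-- The category of flat functors is closed under extensions. -/
lemma essImage_indToSheaf_closed [HasFiniteBiproducts C] (E : ExactStructure C) :
    (indToSheaf E).essImage.IsClosedUnderExtensions where
  prop_X₂_of_shortExact {S} hS h₁ h₃ := by
    have := hasBinaryBiproducts_of_finite_biproducts C
    obtain ⟨X₁, ⟨e₁⟩⟩ := h₁
    obtain ⟨X₃, ⟨e₃⟩⟩ := h₃
    have hf₁ := isInd_of_iso ((sheafToPresheaf _ _).mapIso e₁) X₁.property
    have hf₃ := isInd_of_iso ((sheafToPresheaf _ _).mapIso e₃) X₃.property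
    have h₂ := (locExact_of_shortExact hS).isFlatPsh (isFlatPsh_of_isInd hf₁)
      (isFlatPsh_of_isInd hf₃) S.X₂.property
    exact ⟨⟨S.X₂.obj, (isInd_iff_isFlatPsh _).2 h₂⟩, ⟨Iso.refl _⟩⟩

lemma exists_isZero_indToSheaf [HasFiniteBiproducts C] (E : ExactStructure C) :
    ∃ Z : IndCompletion C, IsZero ((indToSheaf E).obj Z) := by
  obtain ⟨Z, hZ⟩ := HasZeroObject.zero (C := C)
  refine ⟨⟨preadditiveYoneda.obj Z, (isInd_iff_isFlatPsh _).2 (isFlatPsh_yoneda Z)⟩, ?_⟩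
  rw [IsZero.iff_id_eq_zero]
  ext W φ
  exact hZ.eq_of_tgt (φ : W.unop ⟶ Z) 0

/-- The ind-completion of the exact category `(C, E)`, as an exact structure on the ind-completion
of the additive category `C`. -/
noncomputable def indCompletion [HasFiniteBiproducts C] (E : ExactStructure C) :
    ExactStructure (IndCompletion C) :=
  (fullyExact (indToSheaf E) (exists_isZero_indToSheaf E) (essImage_indToSheaf_closed E)).copy
    (indConflation E) (indConflation_eq E)

end Coherent

end ExactCat

/-! The two sides are defined inside different abelian categories, `LexCategory E`, `LexCategory F`
and `LexCategory (E ⊓ F)`, so the first task is to compare them on common ground. This is what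
`indConflation_iff` provides: exactness of `X₁ ⟶ X₂ ⟶ X₃` in the category of left exact functors
amounts to `LocExact`, a condition on the underlying presheaves. Kernels of left exact functors are
computed objectwise, so the clauses `zero`, `inj` and `exact` do not see the exact structure at all.
Only `surj` does: every section of the third term lifts to the second one after restriction along
some deflation.

Passing to a larger exact structure supplies more deflations, hence a weaker condition; this is
`LocExact.mono`, and it gives one inclusion.

For the other inclusion, a section `x` over `X` lifts along an `E`-deflation `d : W ⟶ X` and also
along an `F`-deflation `d' : W' ⟶ X`, and a single morphism is needed that is a deflation for both
structures. The fibre product of `d` and `d'` is of no use: its map to `X` is a composite of an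
`E`-deflation with an `F`-deflation, and need not be a deflation for either. The biproduct works
instead. The morphism `biprod.desc d d' : W ⊞ W' ⟶ X` is an `E`-deflation because `d` is one,
whatever `d'` may be, and an `F`-deflation because `d'` is one; so it is a deflation for `E ⊓ F` by
`deflation_inf`. As the third term is additive, the restriction of `x` to `W ⊞ W'` is the sum of the
two pulled-back restrictions of `x`, and the sum of the two pulled-back lifts lies above it. This is
`LocExact.inf`. -/

namespace ExactCat

/-! ### Deflations out of a biproduct -/

namespace ExactStructure

variable {A : Type u} [Category.{v} A] [Preadditive A] [HasBinaryBiproducts A]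
  (E : ExactStructure A)

/-- An inflation forms a conflation with any choice of its cokernel; here the inflation is
`biprod.inl`. -/
lemma deflation_snd (Q Z : A) : IsDeflation E.conflation (biprod.snd : Q ⊞ Z ⟶ Z) :=
  ⟨Q, biprod.inl, biprod.inl_snd, E.conflation_of_inflation _ _ _ (E.inflation_inl Q Z)
    ⟨biprod.isCokernelInlCokernelFork Q Z⟩⟩

/-- Adding an arbitrary component `k` to a deflation does no harm, because the result factors as
`biprod.map (𝟙 Q) d` followed by `biprod.desc k (𝟙 Z)`. The first factor is a base change of `d`,
and the second is a projection up to a shear automorphism of `Q ⊞ Z`. Nothing is asked of `k`, which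
is what allows it to be a deflation for a different exact structure. -/
lemma deflation_biprod_desc_right {Q Y Z : A} (k : Q ⟶ Z) {d : Y ⟶ Z}
    (hd : IsDeflation E.conflation d) : IsDeflation E.conflation (biprod.desc k d) := by
  obtain ⟨P, f, p, sq, hp⟩ := E.deflation_pullback d (biprod.snd : Q ⊞ Z ⟶ Z) hd
  -- The axiom only yields some pullback of `d` along the projection. This square is an explicit
  -- one, so its second leg is a deflation by uniqueness of pullbacks.
  have sq' : IsPullback (biprod.snd : Q ⊞ Y ⟶ Y) (biprod.map (𝟙 Q) d) d biprod.snd :=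
    ⟨⟨by simp⟩, ⟨PullbackCone.IsLimit.mk _ (fun s => biprod.lift (s.snd ≫ biprod.fst) s.fst)
      (fun s => by simp) (fun s => by ext <;> simp [s.condition])
      (fun s m h h' => by
        ext
        · simp [← h']
        · simp [h])⟩⟩
  have h₁ := E.deflation_of_iso hp (sq.isoIsPullback _ _ sq') (biprod.map (𝟙 Q) d) (by simp)
  -- The shear `(q, z) ↦ (q, k q + z)` followed by the projection to `Z` is `biprod.desc k (𝟙 Z)`;
  -- the inverse shear carries it back to `biprod.snd`.
  have h₂ := E.deflation_of_iso (E.deflation_snd Q Z) (Biprod.unipotentUpper k).symm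
    (biprod.desc k (𝟙 Z)) (by rw [Iso.symm_hom, Iso.inv_comp_eq]; ext <;> simp)
  have := E.deflation_comp _ _ h₁ h₂
  have e : biprod.map (𝟙 Q) d ≫ biprod.desc k (𝟙 Z) = biprod.desc k d := by ext <;> simp
  rwa [e] at this

lemma deflation_biprod_desc_left {Q Y Z : A} {d : Y ⟶ Z} (hd : IsDeflation E.conflation d)
    (k : Q ⟶ Z) : IsDeflation E.conflation (biprod.desc d k) :=
  E.deflation_of_iso (E.deflation_biprod_desc_right k hd) (biprod.braiding Q Y) _
    (by ext <;> simp)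

end ExactStructure

/-! ### Local exactness under a change of exact structure -/

variable {C : Type u} [SmallCategory C] [Preadditive C] {E E' : ExactStructure C}
  {F G H : Cᵒᵖ ⥤ AddCommGrpCat.{u}} {i : F ⟶ G} {p : G ⟶ H}

/-- Every `E`-deflation is an `E'`-deflation, so the same local lifts serve. -/
lemma LocExact.mono (hE : E ≤ E') (h : LocExact E i p) : LocExact E' i p where
  zero := h.zero
  inj := h.inj
  exact := h.exact
  surj X x := by
    obtain ⟨W, d, w, ⟨K, κ, z, hκ⟩, hw⟩ := h.surj X x
    exact ⟨W, d, w, ⟨K, κ, z, hE _ hκ⟩, hw⟩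

/-- This carries the nontrivial inclusion: a lift along a deflation of each structure is turned into
one lift along a common deflation. -/
lemma LocExact.inf [HasBinaryBiproducts C] (hH : H.Additive) (h : LocExact E i p)
    (h' : LocExact E' i p) : LocExact (E ⊓ E') i p where
  zero := h.zero
  inj := h.inj
  exact := h.exact
  surj X x := by
    obtain ⟨W, d, w, hd, hw⟩ := h.surj X x
    obtain ⟨W', d', w', hd', hw'⟩ := h'.surj X x
    -- The cover has components `d` and `d'`. For `E` the first is the deflation and the second is
    -- arbitrary; for `E'` the roles are exchanged.
    refine ⟨W ⊞ W', biprod.desc d d', res G biprod.fst w + res G biprod.snd w',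
      ExactStructure.deflation_inf E E' (E.deflation_biprod_desc_left hd d')
        (E'.deflation_biprod_desc_right d hd'), ?_⟩
    refine (map_add (p.app _).hom _ _).trans
      ((congrArg₂ (· + ·) (app_res p biprod.fst w) (app_res p biprod.snd w')).trans ?_)
    -- Additivity of `H` enters here: restrictions of `x` along `biprod.fst ≫ d` and `biprod.snd ≫
    -- d'` add up to the restriction along the sum of these morphisms, which is `biprod.desc d d'`.
    rw [hw, hw', ← res_comp, ← res_comp, ← res_add_hom, biprod.desc_eq]

end ExactCat

/-! ### Ind-completion commutes with meets -/

theorem mainTheorem7 {C : Type u} [SmallCategory C] [Preadditive C] [HasFiniteBiproducts C]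
    (E F : ExactCat.ExactStructure C) :
    ExactCat.indCompletion E ⊓ ExactCat.indCompletion F = ExactCat.indCompletion (E ⊓ F) := by
  have := hasBinaryBiproducts_of_finite_biproducts C
  ext S
  -- Holds by definition: conflations of a meet are the common ones, and those of `indCompletion`
  -- are literally `indConflation`.
  change ExactCat.indConflation E S ∧ ExactCat.indConflation F S ↔
    ExactCat.indConflation (E ⊓ F) S
  simp only [ExactCat.indConflation_iff]
  -- The third term is a filtered colimit of representables, hence flat and in particular additive.
  exact ⟨fun h => h.1.inf (ExactCat.isFlatPsh_of_isInd S.X₃.property).1 h.2,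
    fun h => ⟨h.mono inf_le_left, h.mono inf_le_right⟩⟩
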